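/- For integers $m\ge 1$ and $n,k\ge 0$ let ${n\brace k}_{\ge m}$ be the associated Stirling number of the second kind, i.e. the number of partitions of an $n$-element set into $k$ nonempty blocks, each containing at least $m$ elements. For $\mu\in\mathbb C$ define the associated poly-Bernoulli numbers by $$B_{n,\ge m}^{(\mu)}=\sum_{k=0}^n(-1)^{n-k}\frac{k!}{(k+1)^\mu}{n\brace k}_{\ge m}\qquad(n\ge 0).$$ For $k\in\mathbb Z$ let $W_k$ be the $k$-th branch of the Lambert $W$ function (with the standard branch cuts), so that $W_k(a)e^{W_k(a)}=a$; in particular $W_0(-1)=\overline{W_{-1}(-1)}\approx -0.318132+1.337236\,i$. Theorem. For every $\mu\in\mathbb C$ with $\Re(\mu)>1$ and for $k=0$ and $k=-1$, the series below converges (absolutely) and $$\zeta(\mu)=\sum_{n=0}^\infty B_{n,\ge 2}^{(\mu)}\,\frac{(W_k(-1))^n}{n!},$$ where $\zeta$ is the Riemann zeta function. -/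

import Mathlib

noncomputable section

/-- The associated Stirling number of the second kind `{n, k}_{≥ m}`: the number of partitions of
an `n`-element set into `k` (nonempty) blocks, each of which has at least `m` elements. -/
def associatedStirlingSecond (m n k : ℕ) : ℕ :=
  (Finset.univ.filter fun P : Finpartition (Finset.univ : Finset (Fin n)) =>
    P.parts.card = k ∧ ∀ b ∈ P.parts, m ≤ b.card).card

/-- The associated poly-Bernoulli number
`B_{n, ≥ m}^{(μ)} = ∑_{k=0}^n (-1)^{n-k} k! / (k+1)^μ {n, k}_{≥ m}`, for complex `μ`. -/
def associatedPolyBernoulli (m : ℕ) (μ : ℂ) (n : ℕ) : ℂ :=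
  ∑ k ∈ Finset.range (n + 1),
    (-1 : ℂ) ^ (n - k) * ((k.factorial : ℂ) / ((k : ℂ) + 1) ^ μ) *
      (associatedStirlingSecond m n k : ℂ)

/-- The range of the `k`-th branch of the Lambert `W` function, with the standard branch cuts:
the points `w` with `(2k-1)π < Im w + arg w ≤ (2k+1)π` (that is, `w + Log w = Log (w e^w) + 2πik`
when `w ≠ 0`), except that the real half-line `(-∞, -1)` is moved from the principal branch to the
branch `-1`, whose range also contains the branch point value `-1`. -/
def lambertWRange (k : ℤ) : Set ℂ :=
  {w | ((2 * (k : ℝ) - 1) * Real.pi < w.im + w.arg ∧ w.im + w.arg ≤ (2 * (k : ℝ) + 1) * Real.pi ∧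
        ¬ (w.im = 0 ∧ w.re < -1)) ∨
       (k = -1 ∧ w.im = 0 ∧ w.re ≤ -1)}

open Classical in
/-- The `k`-th branch `W_k` of the Lambert `W` function: `W_k(z)` is the solution `w` of
`w e^w = z` in the range of the branch. (It exists and is unique, except for `z = 0`, `k ≠ 0`,
where there is none and the value is set to `0`.) -/
def lambertW (k : ℤ) (z : ℂ) : ℂ :=
  if h : ∃ w : ℂ, w ∈ lambertWRange k ∧ w * Complex.exp w = z then h.choose else 0

end

/-!
Let `w = W_k(-1)`, so that `w + e^{-w} = 0`, put `h(x) = w x + e^{-w x}` and view `G = 1 - h` as an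
element of the Wiener algebra of absolutely convergent power series on the closed unit disc. Up to
sign, `G` is the exponential generating function of a block of size at least `2` evaluated at
`-w x`, so the coefficient of `xⁿ` in the Bochner integral `∫₀^∞ t^(μ-1) (e^t - G)⁻¹ dt` is `Γ(μ)`
times the `n`-th term of the series. As `G(1) = 1`, the value of the integral at `x = 1` is
`∫₀^∞ t^(μ-1) (e^t - 1)⁻¹ dt = Γ(μ) ζ(μ)`, and a member of the Wiener algebra is the sum of its
series at every point of the closed disc.

What remains is the convergence of the integral at `t = 0`, for which the estimate
`‖(s + h)⁻¹‖ ≤ K / s` for `s > 0` suffices. It holds because the zeros of `h` in the closed disc,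
which are `1` and `conj w / w`, are simple, lie on the unit circle and satisfy
`Re (z * deriv h z) < 0`, so that adding `s > 0` to `h` moves them out of the disc.
-/

open Filter PowerSeries Set Topology
open scoped ComplexConjugate

section WienerAlgebra

variable {𝕜 : Type*} [NormedField 𝕜]

variable (𝕜) in
/-- The Wiener algebra of power series with absolutely summable coefficients, a Banach algebra
under the norm `∑ ‖fₙ‖`. -/
def wienerAlgebra : Subalgebra 𝕜 𝕜⟦X⟧ where
  carrier := {f | Summable fun n => ‖coeff n f‖}
  mul_mem' hf hg := by
    simpa only [mem_ofPred_eq, coeff_mul] using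
      summable_norm_sum_mul_antidiagonal_of_summable_norm hf hg
  add_mem' hf hg := (hf.add hg).of_nonneg_of_le (fun _ => norm_nonneg _) fun n => by
    simpa only [map_add] using norm_add_le _ _
  algebraMap_mem' c := summable_of_ne_finset_zero (s := {0}) fun n hn => by
    rw [PowerSeries.algebraMap_apply, coeff_C, if_neg (Finset.notMem_singleton.1 hn), norm_zero]

namespace wienerAlgebra

lemma mem_iff {f : 𝕜⟦X⟧} : f ∈ wienerAlgebra 𝕜 ↔ Summable fun n => ‖coeff n f‖ := Iff.rfl

variable (𝕜) in
/-- The coefficient sequence, as an element of `ℓ¹`, whose norm and completeness are pulled back. -/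
noncomputable def toLp : wienerAlgebra 𝕜 →ₗ[𝕜] lp (fun _ : ℕ => 𝕜) 1 where
  toFun f := ⟨fun n => coeff n (f : 𝕜⟦X⟧), memℓp_gen <| by simpa using mem_iff.1 f.2⟩
  map_add' f g := Subtype.ext <| funext fun n => map_add (coeff n) (f : 𝕜⟦X⟧) g
  map_smul' c f := Subtype.ext <| funext fun n => map_smul (coeff n) c (f : 𝕜⟦X⟧)

lemma toLp_bijective : Function.Bijective (toLp 𝕜) := by
  refine ⟨fun f g hfg => Subtype.ext <| PowerSeries.ext fun n =>
    congr_fun (congr_arg Subtype.val hfg) n, fun a => ⟨⟨mk a, mem_iff.2 ?_⟩, ?_⟩⟩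
  · simpa using (memℓp_gen_iff (by simp)).1 a.2
  · ext n
    exact coeff_mk n a

noncomputable instance : NormedAddCommGroup (wienerAlgebra 𝕜) :=
  NormedAddCommGroup.induced _ _ (toLp 𝕜) toLp_bijective.injective

lemma norm_eq_tsum (f : wienerAlgebra 𝕜) : ‖f‖ = ∑' n, ‖coeff n (f : 𝕜⟦X⟧)‖ := by
  have h := lp.norm_eq_tsum_rpow (by simp) (toLp 𝕜 f)
  simp only [ENNReal.toReal_one, Real.rpow_one, div_one] at h
  exact h

lemma norm_coeff_le (f : wienerAlgebra 𝕜) (n : ℕ) : ‖coeff n (f : 𝕜⟦X⟧)‖ ≤ ‖f‖ :=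
  norm_eq_tsum f ▸ (mem_iff.1 f.2).le_tsum n fun _ _ => norm_nonneg _

protected lemma norm_mul_le (f g : wienerAlgebra 𝕜) : ‖f * g‖ ≤ ‖f‖ * ‖g‖ := by
  have hf := mem_iff.1 f.2
  have hg := mem_iff.1 g.2
  have hfg := summable_norm_sum_mul_antidiagonal_of_summable_norm hf.norm hg.norm
  simp only [norm_eq_tsum, MulMemClass.coe_mul, coeff_mul]
  rw [tsum_mul_tsum_eq_tsum_sum_antidiagonal_of_summable_norm hf.norm hg.norm]
  refine (summable_norm_sum_mul_antidiagonal_of_summable_norm hf hg).tsum_le_tsum (fun n => ?_)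
    hfg.of_norm
  exact (norm_sum_le _ _).trans_eq (Finset.sum_congr rfl fun _ _ => norm_mul _ _)

noncomputable instance : NormedCommRing (wienerAlgebra 𝕜) :=
  { (inferInstance : NormedAddCommGroup (wienerAlgebra 𝕜)),
    (inferInstance : CommRing (wienerAlgebra 𝕜)) with
    norm_mul_le := wienerAlgebra.norm_mul_le }

noncomputable instance : NormedAlgebra 𝕜 (wienerAlgebra 𝕜) where
  norm_smul_le c f := by
    simp only [norm_eq_tsum, SetLike.val_smul, map_smul, smul_eq_mul, norm_mul, tsum_mul_left,
      le_refl]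

instance : NormOneClass (wienerAlgebra 𝕜) where
  norm_one := by
    rw [norm_eq_tsum, tsum_eq_single 0 fun n hn => by simp [coeff_one, hn]]
    simp

instance [CompleteSpace 𝕜] : CompleteSpace (wienerAlgebra 𝕜) :=
  (IsometryEquiv.mk (Equiv.ofBijective _ toLp_bijective)
    (AddMonoidHomClass.isometry_of_norm (toLp 𝕜) fun _ => rfl)).completeSpace

variable (𝕜) in
/-- The `n`-th coefficient as a continuous linear functional, which commutes with integrals. -/
noncomputable def coeffCLM (n : ℕ) : wienerAlgebra 𝕜 →L[𝕜] 𝕜 :=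
  ((coeff n).comp (wienerAlgebra 𝕜).val.toLinearMap).mkContinuous 1 fun f => by
    simpa using norm_coeff_le f n

lemma coeffCLM_apply (n : ℕ) (f : wienerAlgebra 𝕜) : coeffCLM 𝕜 n f = coeff n (f : 𝕜⟦X⟧) := rfl

lemma summable_norm_coeff_mul_pow (f : wienerAlgebra 𝕜) {x : 𝕜} (hx : ‖x‖ ≤ 1) :
    Summable fun n => ‖coeff n (f : 𝕜⟦X⟧) * x ^ n‖ :=
  (mem_iff.1 f.2).of_nonneg_of_le (fun _ => norm_nonneg _) fun n => by
    rw [norm_mul, norm_pow]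
    exact mul_le_of_le_one_right (norm_nonneg _) (pow_le_one₀ (norm_nonneg _) hx)

section Eval

variable [CompleteSpace 𝕜]

/-- Evaluation at a point of the closed unit disc. -/
noncomputable def eval (x : Metric.closedBall (0 : 𝕜) 1) : wienerAlgebra 𝕜 →ₐ[𝕜] 𝕜 where
  toFun f := ∑' n, coeff n (f : 𝕜⟦X⟧) * (x : 𝕜) ^ n
  map_one' := by
    rw [tsum_eq_single 0 fun n hn => by simp [coeff_one, hn]]
    simp
  map_mul' f g := by
    have hx := mem_closedBall_zero_iff.1 x.2
    rw [tsum_mul_tsum_eq_tsum_sum_antidiagonal_of_summable_norm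
      (summable_norm_coeff_mul_pow f hx) (summable_norm_coeff_mul_pow g hx)]
    refine tsum_congr fun n => ?_
    rw [MulMemClass.coe_mul, coeff_mul, Finset.sum_mul]
    refine Finset.sum_congr rfl fun p hp => ?_
    rw [← Finset.HasAntidiagonal.mem_antidiagonal.1 hp, pow_add]
    ring
  map_zero' := by simp
  map_add' f g := by
    have hx := mem_closedBall_zero_iff.1 x.2
    simp only [AddMemClass.coe_add, map_add, add_mul]
    exact (summable_norm_coeff_mul_pow f hx).of_norm.tsum_add
      (summable_norm_coeff_mul_pow g hx).of_norm
  commutes' c := by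
    rw [tsum_eq_single 0 fun n hn => by simp [coeff_C, hn]]
    simp

lemma hasSum_eval (x : Metric.closedBall (0 : 𝕜) 1) (f : wienerAlgebra 𝕜) :
    HasSum (fun n => coeff n (f : 𝕜⟦X⟧) * (x : 𝕜) ^ n) (eval x f) :=
  (summable_norm_coeff_mul_pow f (mem_closedBall_zero_iff.1 x.2)).of_norm.hasSum

end Eval

variable (𝕜) in
/-- The coordinate function of the disc. -/
protected noncomputable def X : wienerAlgebra 𝕜 :=
  ⟨PowerSeries.X, summable_of_ne_finset_zero (s := {1}) fun n hn => by
    rw [coeff_X, if_neg (Finset.notMem_singleton.1 hn), norm_zero]⟩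

lemma norm_X : ‖wienerAlgebra.X 𝕜‖ = 1 := by
  rw [norm_eq_tsum, tsum_eq_single 1 fun n hn => by simp [wienerAlgebra.X, coeff_X, hn]]
  simp [wienerAlgebra.X]

lemma eval_X [CompleteSpace 𝕜] (x : Metric.closedBall (0 : 𝕜) 1) :
    eval x (wienerAlgebra.X 𝕜) = x :=
  (tsum_eq_single 1 fun n hn => by simp [wienerAlgebra.X, coeff_X, hn]).trans
    (by simp [wienerAlgebra.X])

lemma ext_eval {𝕜 : Type*} [NontriviallyNormedField 𝕜] [CompleteSpace 𝕜] {f g : wienerAlgebra 𝕜}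
    (h : ∀ x, eval x f = eval x g) : f = g := by
  have hasFPowerSeries (k : wienerAlgebra 𝕜) (hk : ∀ x, eval x k = eval x f) :
      HasFPowerSeriesAt (fun x : 𝕜 => ∑' n, coeff n (f : 𝕜⟦X⟧) * x ^ n)
        (.ofScalars 𝕜 fun n => coeff n (k : 𝕜⟦X⟧)) 0 := by
    refine hasFPowerSeriesAt_iff.2 ?_
    filter_upwards [Metric.closedBall_mem_nhds 0 one_pos] with x hx
    have hsum := hasSum_eval ⟨x, hx⟩ k
    rw [hk, ← (hasSum_eval ⟨x, hx⟩ f).tsum_eq] at hsum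
    simpa only [FormalMultilinearSeries.coeff_ofScalars, smul_eq_mul, mul_comm, zero_add] using hsum
  have heq := (hasFPowerSeries f fun _ => rfl).eq_formalMultilinearSeries
    (hasFPowerSeries g fun x => (h x).symm)
  exact Subtype.ext <| PowerSeries.ext
    (congr_fun (FormalMultilinearSeries.ofScalars_series_injective 𝕜 𝕜 heq))

lemma exists_eval_eq {f : ℂ → ℂ} (hf : AnalyticOnNhd ℂ f (Metric.closedBall 0 1)) :
    ∃ a : wienerAlgebra ℂ, ∀ x, eval x a = f x := by
  obtain ⟨δ, hδ, hsub⟩ := (isCompact_closedBall (0 : ℂ) 1).exists_thickening_subset_open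
    (isOpen_analyticAt ℂ f) hf
  rw [thickening_closedBall hδ zero_le_one] at hsub
  have hdiff : DifferentiableOn ℂ f (Metric.ball 0 (δ + 1)) := fun x hx =>
    (hsub hx).differentiableAt.differentiableWithinAt
  have hsum {x : ℂ} (hx : ‖x‖ ≤ 1) :
      HasSum (fun n => (n.factorial : ℂ)⁻¹ * iteratedDeriv n f 0 * x ^ n) (f x) := by
    have h := Complex.hasSum_taylorSeries_on_ball hdiff (z := x)
      (mem_ball_zero_iff.2 (by linarith))
    simpa only [sub_zero, smul_eq_mul, mul_assoc, mul_comm (x ^ _)] using h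
  refine ⟨⟨mk fun n => (n.factorial : ℂ)⁻¹ * iteratedDeriv n f 0, mem_iff.2 ?_⟩, fun x =>
    (hasSum_eval x _).unique ?_⟩
  · simpa using (hsum norm_one.le).summable.norm
  · simpa only [coeff_mk] using hsum (mem_closedBall_zero_iff.1 x.2)

lemma isUnit_of_eval_ne_zero {a : wienerAlgebra ℂ} {f : ℂ → ℂ}
    (hf : AnalyticOnNhd ℂ f (Metric.closedBall 0 1)) (ha : ∀ x, eval x a = f x)
    (hne : ∀ x ∈ Metric.closedBall (0 : ℂ) 1, f x ≠ 0) : IsUnit a := by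
  obtain ⟨b, hb⟩ := exists_eval_eq (hf.inv hne)
  exact .of_mul_eq_one b <| ext_eval fun x => by
    rw [map_mul, map_one, ha, hb, Pi.inv_apply, mul_inv_cancel₀ (hne x x.2)]

end wienerAlgebra

end WienerAlgebra

section ResolventBound

lemma exists_algebraMap_sub_mul_eq_one {𝕜 A : Type*} [NormedField 𝕜] [NormedRing A]
    [NormedAlgebra 𝕜 A] [NormOneClass A] [CompleteSpace A] {ρ : 𝕜} {x : A} (h : ‖x‖ < ‖ρ‖) :
    ∃ v : A, (algebraMap 𝕜 A ρ - x) * v = 1 ∧ ‖v‖ ≤ (‖ρ‖ - ‖x‖)⁻¹ := by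
  obtain ⟨v, hv⟩ := (spectrum.mem_resolventSet_of_norm_lt h).exists_right_inv
  refine ⟨v, hv, ?_⟩
  have hρv : ρ • v = 1 + x * v := by
    rw [Algebra.smul_def, ← hv, sub_mul, sub_add_cancel]
  have hnorm : ‖ρ‖ * ‖v‖ ≤ 1 + ‖x‖ * ‖v‖ :=
    calc ‖ρ‖ * ‖v‖ = ‖1 + x * v‖ := by rw [← norm_smul, hρv]
      _ ≤ 1 + ‖x‖ * ‖v‖ := by
        simpa only [norm_one] using
          (norm_add_le _ _).trans (add_le_add_right (norm_mul_le x v) ‖(1 : A)‖)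
  rw [inv_eq_one_div, le_div_iff₀ (sub_pos.2 h)]
  linarith

variable {A : Type*} [NormedCommRing A] [NormedAlgebra ℂ A]

/-- The resolvent estimate `‖(s + a)⁻¹‖ ≤ K / s` for `s` in a set of the filter `l`. For
`l = 𝓝[>] 0` it is local; for `l = 𝓟 (Ioi 0)` it says that `a` is a nonnegative element in the
sense of Balakrishnan. -/
def ResolventBound (l : Filter ℝ) (a : A) : Prop :=
  ∃ K : ℝ, ∀ᶠ s : ℝ in l, ∃ v : A, (algebraMap ℂ A s + a) * v = 1 ∧ ‖v‖ ≤ K / s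

variable [CompleteSpace A]

namespace ResolventBound

/-- The substitution `u = 1 / s` turns `s (s + a)⁻¹` into `(1 + u a)⁻¹`, which is continuous in `u`
on the compact interval left over by the local estimate. -/
lemma of_isUnit {a : A} (hloc : ResolventBound (𝓝[>] 0) a)
    (hunit : ∀ s : ℝ, 0 < s → IsUnit (algebraMap ℂ A s + a)) :
    ResolventBound (𝓟 (Ioi 0)) a := by
  obtain ⟨K, hK⟩ := hloc
  obtain ⟨ε, hε : 0 < ε, hKε⟩ := mem_nhdsGT_iff_exists_Ioo_subset.1 hK
  set f : ℝ → A := fun u => 1 + algebraMap ℂ A u * a with hf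
  have hfactor {s : ℝ} (hs : 0 < s) : algebraMap ℂ A s * f s⁻¹ = algebraMap ℂ A s + a := by
    have : algebraMap ℂ A s * algebraMap ℂ A (s⁻¹ : ℝ) = 1 := by
      rw [← map_mul, ← Complex.ofReal_mul, mul_inv_cancel₀ hs.ne', Complex.ofReal_one, map_one]
    linear_combination a * this
  have hfunit (u : ℝ) (hu : u ∈ Icc 0 ε⁻¹) : IsUnit (f u) := by
    rcases hu.1.eq_or_lt with rfl | hu
    · simp [hf]
    · have h := hunit u⁻¹ (inv_pos.2 hu)
      rw [← hfactor (inv_pos.2 hu), inv_inv] at h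
      exact isUnit_of_mul_isUnit_right h
  have hcont : ContinuousOn (fun u => Ring.inverse (f u)) (Icc 0 ε⁻¹) := fun u hu => by
    obtain ⟨w, hw⟩ := hfunit u hu
    refine ContinuousAt.comp_continuousWithinAt (g := Ring.inverse) ?_ ?_
    · exact hw ▸ NormedRing.inverse_continuousAt w
    · exact (by fun_prop : Continuous f).continuousWithinAt
  obtain ⟨C, hC⟩ := isCompact_Icc.exists_bound_of_continuousOn hcont
  refine ⟨max K C, eventually_principal.2 fun s hs => ?_⟩
  have hs : 0 < s := hs
  rcases lt_or_ge s ε with hsε | hsε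
  · obtain ⟨v, hv, hvK⟩ := hKε ⟨hs, hsε⟩
    exact ⟨v, hv, hvK.trans (by gcongr; exact le_max_left _ _)⟩
  · have hmem : s⁻¹ ∈ Icc 0 ε⁻¹ := ⟨(inv_pos.2 hs).le, inv_anti₀ hε hsε⟩
    refine ⟨algebraMap ℂ A (s⁻¹ : ℝ) * Ring.inverse (f s⁻¹), ?_, ?_⟩
    · rw [← hfactor hs, mul_mul_mul_comm, Ring.mul_inverse_cancel _ (hfunit _ hmem), mul_one,
        ← map_mul, ← Complex.ofReal_mul, mul_inv_cancel₀ hs.ne', Complex.ofReal_one, map_one]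
    · rw [← Algebra.smul_def, norm_smul, Complex.norm_of_nonneg hmem.1, div_eq_inv_mul]
      exact mul_le_mul_of_nonneg_left ((hC _ hmem).trans (le_max_right _ _)) hmem.1

variable [NormOneClass A]

lemma of_approx_inverse {a : A} {K M : ℝ}
    (h : ∀ᶠ s : ℝ in 𝓝[>] 0, ∃ v r : A,
      (algebraMap ℂ A s + a) * v = 1 + algebraMap ℂ A s * r ∧ ‖v‖ ≤ K / s ∧ ‖r‖ ≤ M) :
    ResolventBound (𝓝[>] 0) a := by
  have hsmall : ∀ᶠ s : ℝ in 𝓝[>] 0, s * M < 1 / 2 :=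
    ((continuous_mul_const M).tendsto' 0 0 (zero_mul M)).eventually_lt_const (by norm_num)
      |>.filter_mono nhdsWithin_le_nhds
  refine ⟨K * 2, ?_⟩
  filter_upwards [h, hsmall, self_mem_nhdsWithin] with s ⟨v, r, hv, hvK, hrM⟩ hsM hs
  have hsr : ‖-(algebraMap ℂ A s * r)‖ ≤ 1 / 2 := by
    rw [norm_neg, ← Algebra.smul_def, norm_smul, Complex.norm_of_nonneg (le_of_lt hs)]
    exact (mul_le_mul_of_nonneg_left hrM (le_of_lt hs)).trans hsM.le
  obtain ⟨u, hu, hunorm⟩ := exists_algebraMap_sub_mul_eq_one (𝕜 := ℂ) (ρ := 1)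
    (x := -(algebraMap ℂ A s * r)) (by rw [norm_one]; linarith)
  rw [map_one, sub_neg_eq_add] at hu
  refine ⟨v * u, by rw [← mul_assoc, hv, hu], ?_⟩
  calc ‖v * u‖ ≤ ‖v‖ * ‖u‖ := norm_mul_le _ _
    _ ≤ K / s * 2 := by
      refine mul_le_mul hvK (hunorm.trans ?_) (norm_nonneg _) ((norm_nonneg v).trans hvK)
      rw [norm_one, inv_le_comm₀ (by linarith) two_pos]
      linarith
    _ = K * 2 / s := by ring

/-- Near each factor `l i` of `h` the approximate inverse of `s + h` is `(s + l i)⁻¹`; these are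
patched together by the partition of unity `∑ (1 - l i * k i) + h * q = 1`. -/
lemma of_factors {ι : Type*} {t : Finset ι} {l k : ι → A} {h q : A}
    (hl : ∀ i ∈ t, ResolventBound (𝓝[>] 0) (l i)) (hfac : ∀ i ∈ t, h = l i * (1 - l i * k i))
    (hpart : ∑ i ∈ t, (1 - l i * k i) + h * q = 1) :
    ResolventBound (𝓝[>] 0) h := by
  choose! K hK using hl
  refine of_approx_inverse (K := ‖q‖ + ∑ i ∈ t, K i)
    (M := ‖q‖ + ∑ i ∈ t, ‖k i‖ * (1 + K i)) ?_
  filter_upwards [(Finset.eventually_all t).2 hK, Ioo_mem_nhdsGT one_pos] with s hs ⟨hs0, hs1⟩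
  choose! v hv hvK using hs
  refine ⟨q + ∑ i ∈ t, v i, q + ∑ i ∈ t, k i * (1 - algebraMap ℂ A s * v i), ?_, ?_, ?_⟩
  · have hlocal : ∀ i ∈ t, (algebraMap ℂ A s + h) * v i =
        (1 - l i * k i) + algebraMap ℂ A s * (k i * (1 - algebraMap ℂ A s * v i)) := fun i hi => by
      linear_combination v i * hfac i hi + (1 - l i * k i + algebraMap ℂ A s * k i) * hv i hi
    have hsum := Finset.sum_congr rfl hlocal
    rw [← Finset.mul_sum, Finset.sum_add_distrib, ← Finset.mul_sum] at hsum
    linear_combination hsum + hpart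
  · calc ‖q + ∑ i ∈ t, v i‖ ≤ ‖q‖ + ∑ i ∈ t, K i / s :=
        (norm_add_le _ _).trans (add_le_add_right (norm_sum_le_of_le t hvK) _)
      _ ≤ ‖q‖ / s + ∑ i ∈ t, K i / s :=
        add_le_add_left (le_div_self (norm_nonneg q) hs0 hs1.le) _
      _ = (‖q‖ + ∑ i ∈ t, K i) / s := by rw [add_div, Finset.sum_div]
  · refine (norm_add_le _ _).trans (add_le_add_right (norm_sum_le_of_le t fun i hi => ?_) _)
    have hsv : ‖algebraMap ℂ A s * v i‖ ≤ K i := by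
      rw [← Algebra.smul_def, norm_smul, Complex.norm_of_nonneg hs0.le, ← le_div_iff₀' hs0]
      exact hvK i hi
    calc ‖k i * (1 - algebraMap ℂ A s * v i)‖ ≤ ‖k i‖ * ‖1 - algebraMap ℂ A s * v i‖ :=
          norm_mul_le _ _
      _ ≤ ‖k i‖ * (1 + K i) := mul_le_mul_of_nonneg_left
          ((norm_sub_le _ _).trans (by rw [norm_one]; gcongr)) (norm_nonneg _)

/-- Here `s + d (x - z) = d (x - ρ)` with `ρ = z - s / d`, and `Re (z d) < 0` says that `ρ` leaves
the closed unit disc at a positive speed. -/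
lemma smul_sub_algebraMap {x : A} {z d : ℂ} (hx : ‖x‖ ≤ 1) (hz : ‖z‖ = 1) (hzd : (z * d).re < 0) :
    ResolventBound (𝓝[>] 0) (d • (x - algebraMap ℂ A z)) := by
  have hz0 : z ≠ 0 := by rintro rfl; simp at hz
  have hd : d ≠ 0 := by rintro rfl; simp at hzd
  have hc : 0 < -((z * d)⁻¹).re := by
    rw [Complex.inv_re, neg_pos]
    exact div_neg_of_neg_of_pos hzd (Complex.normSq_pos.2 (mul_ne_zero hz0 hd))
  refine ⟨‖d⁻¹‖ * (-((z * d)⁻¹).re)⁻¹, eventually_mem_nhdsWithin.mono fun s hs => ?_⟩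
  have hs : 0 < s := hs
  have hρ : s * -((z * d)⁻¹).re ≤ ‖z - s * d⁻¹‖ - 1 := by
    have hre := Complex.re_le_norm (z⁻¹ * (z - s * d⁻¹))
    rw [norm_mul, norm_inv, hz, mul_sub, inv_mul_cancel₀ hz0, mul_left_comm, ← mul_inv,
      Complex.sub_re, Complex.one_re, Complex.re_ofReal_mul] at hre
    linarith
  have hsc := mul_pos hs hc
  obtain ⟨v, hv, hvnorm⟩ := exists_algebraMap_sub_mul_eq_one (ρ := z - s * d⁻¹) (x := x)
    (by linarith)
  refine ⟨-(d⁻¹ • v), ?_, ?_⟩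
  · have hdd : algebraMap ℂ A d * algebraMap ℂ A d⁻¹ = 1 := by
      rw [← map_mul, mul_inv_cancel₀ hd, map_one]
    rw [map_sub, map_mul] at hv
    rw [Algebra.smul_def, Algebra.smul_def]
    linear_combination hv + (algebraMap ℂ A z - x) * v * hdd
  · rw [norm_neg, norm_smul, mul_div_assoc]
    refine mul_le_mul_of_nonneg_left (hvnorm.trans ?_) (norm_nonneg _)
    rw [inv_div_left]
    exact inv_anti₀ (by linarith) (by linarith)

end ResolventBound

end ResolventBound

section AnalyticFactorization

variable {𝕜 : Type*} [NontriviallyNormedField 𝕜] {s : Set 𝕜}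

lemma analyticOnNhd_dslope {E : Type*} [NormedAddCommGroup E] [NormedSpace 𝕜 E] {f : 𝕜 → E}
    {a : 𝕜} (hf : AnalyticOnNhd 𝕜 f s) (ha : a ∈ s) : AnalyticOnNhd 𝕜 (dslope f a) s := by
  intro x hx
  rcases eq_or_ne x a with rfl | hxa
  · obtain ⟨p, hp⟩ := hf x hx
    exact ⟨_, hp.has_fpower_series_dslope_fslope⟩
  · have hslope : AnalyticAt 𝕜 (slope f a) x := by
      simp only [slope_fun_def, vsub_eq_sub]
      exact ((analyticAt_id.sub analyticAt_const).inv (sub_ne_zero.2 hxa)).smul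
        ((hf x hx).sub analyticAt_const)
    exact hslope.congr (dslope_eventuallyEq_slope_of_ne f hxa).symm

lemma exists_eq_linear_mul_one_sub {f : 𝕜 → 𝕜} {a : 𝕜} (hf : AnalyticOnNhd 𝕜 f s) (ha : a ∈ s)
    (hfa : f a = 0) (hfa' : deriv f a ≠ 0) :
    ∃ k : 𝕜 → 𝕜, AnalyticOnNhd 𝕜 k s ∧
      ∀ x, f x = deriv f a * (x - a) * (1 - deriv f a * (x - a) * k x) := by
  have hslope := analyticOnNhd_dslope hf ha
  refine ⟨fun x => -(deriv f a ^ 2)⁻¹ * dslope (dslope f a) a x,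
    analyticOnNhd_const.mul (analyticOnNhd_dslope hslope ha), fun x => ?_⟩
  have hfirst : (x - a) * dslope f a x = f x := sub_smul_dslope_of_zero hfa x
  have hsecond : (x - a) * dslope (dslope f a) a x = dslope f a x - deriv f a := by
    simpa only [smul_eq_mul, dslope_same] using sub_smul_dslope (dslope f a) a x
  rw [← hfirst]
  field_simp
  linear_combination (a - x) * hsecond

lemma exists_eq_mul_of_simple_zeros {f g : 𝕜 → 𝕜} (hf : AnalyticOnNhd 𝕜 f s)
    (hg : AnalyticOnNhd 𝕜 g s) (hzero : ∀ x ∈ s, g x = 0 → f x = 0 ∧ deriv g x ≠ 0) :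
    ∃ q : 𝕜 → 𝕜, AnalyticOnNhd 𝕜 q s ∧ ∀ x ∈ s, f x = g x * q x := by
  classical
  refine ⟨fun x => if g x = 0 then deriv f x / deriv g x else f x / g x, fun a ha => ?_,
    fun x hx => ?_⟩
  · by_cases hga : g a = 0
    · obtain ⟨hfa, hga'⟩ := hzero a ha hga
      have hdg := analyticOnNhd_dslope hg ha a ha
      have hne : ∀ᶠ x in 𝓝 a, dslope g a x ≠ 0 :=
        hdg.continuousAt.eventually_ne (by rwa [dslope_same])
      refine ((analyticOnNhd_dslope hf ha a ha).div hdg (by rwa [dslope_same])).congr ?_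
      filter_upwards [hne] with x hx
      rcases eq_or_ne x a with rfl | hxa
      · rw [if_pos hga, Pi.div_apply, dslope_same, dslope_same]
      · have hgx : (x - a) * dslope g a x = g x := sub_smul_dslope_of_zero hga x
        have hfx : (x - a) * dslope f a x = f x := sub_smul_dslope_of_zero hfa x
        have hxa := sub_ne_zero.2 hxa
        rw [if_neg (hgx ▸ mul_ne_zero hxa hx), ← hfx, ← hgx, mul_div_mul_left _ _ hxa, Pi.div_apply]
    · refine ((hf a ha).div (hg a ha) hga).congr ?_
      filter_upwards [(hg a ha).continuousAt.eventually_ne hga] with x hx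
      rw [if_neg hx, Pi.div_apply]
  · by_cases hgx : g x = 0
    · rw [hgx, zero_mul, (hzero x hx hgx).1]
    · simp only [if_neg hgx, mul_div_cancel₀ _ hgx]

lemma exists_partition_of_simple_zeros {f : 𝕜 → 𝕜} {Z : Finset 𝕜} (hf : AnalyticOnNhd 𝕜 f s)
    (hZ : ∀ z ∈ Z, z ∈ s ∧ f z = 0 ∧ deriv f z ≠ 0) (hmem : ∀ x ∈ s, f x = 0 → x ∈ Z) :
    ∃ (k : 𝕜 → 𝕜 → 𝕜) (q : 𝕜 → 𝕜), (∀ z ∈ Z, AnalyticOnNhd 𝕜 (k z) s) ∧ AnalyticOnNhd 𝕜 q s ∧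
      (∀ z ∈ Z, ∀ x, f x = deriv f z * (x - z) * (1 - deriv f z * (x - z) * k z x)) ∧
      ∀ x ∈ s, ∑ z ∈ Z, (1 - deriv f z * (x - z) * k z x) + f x * q x = 1 := by
  choose! k hk hfac using fun z hz =>
    exists_eq_linear_mul_one_sub hf (hZ z hz).1 (hZ z hz).2.1 (hZ z hz).2.2
  set g : 𝕜 → 𝕜 → 𝕜 := fun z x => 1 - deriv f z * (x - z) * k z x with hg
  have hg_of_ne {z x : 𝕜} (hz : z ∈ Z) (hxz : x ≠ z) (hx : f x = 0) : g z x = 0 :=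
    (mul_eq_zero.1 ((hfac z hz x).symm.trans hx)).resolve_left
      (mul_ne_zero (hZ z hz).2.2 (sub_ne_zero.2 hxz))
  have hg_sum {x : 𝕜} (hx : x ∈ Z) : ∑ z ∈ Z, g z x = 1 := by
    rw [Finset.sum_eq_single_of_mem x hx fun z hz hzx => hg_of_ne hz hzx.symm (hZ x hx).2.1]
    simp [hg]
  have hg_analytic : ∀ z ∈ Z, AnalyticOnNhd 𝕜 (g z) s := fun z hz =>
    analyticOnNhd_const.sub ((analyticOnNhd_const.mul
      (analyticOnNhd_id.sub analyticOnNhd_const)).mul (hk z hz))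
  have hrest : AnalyticOnNhd 𝕜 (fun x => 1 - ∑ z ∈ Z, g z x) s :=
    analyticOnNhd_const.sub (Finset.analyticOnNhd_fun_sum Z hg_analytic)
  obtain ⟨q, hq, hfq⟩ := exists_eq_mul_of_simple_zeros hrest hf fun x hx hx0 =>
    ⟨sub_eq_zero.2 (hg_sum (hmem x hx hx0)).symm, (hZ x (hmem x hx hx0)).2.2⟩
  exact ⟨k, q, hk, hq, hfac, fun x hx => by rw [← hfq x hx, add_sub_cancel]⟩

end AnalyticFactorization

section ResolventOfAnalytic

open wienerAlgebra

theorem resolventBound_of_eval {a : wienerAlgebra ℂ} {h : ℂ → ℂ} {Z : Finset ℂ}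
    (hh : AnalyticOnNhd ℂ h (Metric.closedBall 0 1)) (ha : ∀ x, eval x a = h x)
    (hZ : ∀ z ∈ Z, ‖z‖ = 1 ∧ h z = 0 ∧ (z * deriv h z).re < 0)
    (hmem : ∀ x ∈ Metric.closedBall (0 : ℂ) 1, h x = 0 → x ∈ Z)
    (hpos : ∀ s : ℝ, 0 < s → ∀ x ∈ Metric.closedBall (0 : ℂ) 1, s + h x ≠ 0) :
    ResolventBound (𝓟 (Ioi 0)) a := by
  have hsimple (z : ℂ) (hz : z ∈ Z) :
      z ∈ Metric.closedBall (0 : ℂ) 1 ∧ h z = 0 ∧ deriv h z ≠ 0 := by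
    obtain ⟨hnorm, h0, hre⟩ := hZ z hz
    refine ⟨mem_closedBall_zero_iff.2 hnorm.le, h0, fun hd => ?_⟩
    simp [hd] at hre
  obtain ⟨k, q, hk, hq, hfac, hpart⟩ := exists_partition_of_simple_zeros hh hsimple hmem
  choose! K hK using fun z (hz : z ∈ Z) => exists_eval_eq (hk z hz)
  obtain ⟨Q, hQ⟩ := exists_eval_eq hq
  have hlinear (z : ℂ) (x : Metric.closedBall (0 : ℂ) 1) :
      eval x (deriv h z • (wienerAlgebra.X ℂ - algebraMap ℂ _ z)) =
      deriv h z * ((x : ℂ) - z) := by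
    rw [map_smul, map_sub, eval_X, AlgHom.commutes, smul_eq_mul, Algebra.algebraMap_self_apply]
  refine ResolventBound.of_isUnit (ResolventBound.of_factors (k := K) (q := Q)
    (fun z hz => .smul_sub_algebraMap norm_X.le (hZ z hz).1 (hZ z hz).2.2)
    (fun z hz => ext_eval fun x => ?_) (ext_eval fun x => ?_)) fun s hs => ?_
  · rw [map_mul, map_sub, map_mul, map_one, hlinear, ha, hK z hz, hfac z hz]
  · rw [map_add, map_sum, map_mul, map_one, ha, hQ, ← hpart x x.2]
    refine congr_arg (· + _) (Finset.sum_congr rfl fun z hz => ?_)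
    rw [map_sub, map_mul, map_one, hlinear, hK z hz]
  · refine isUnit_of_eval_ne_zero (f := fun x => s + h x) (analyticOnNhd_const.add hh) (fun x => ?_)
      (hpos s hs)
    rw [map_add, AlgHom.commutes, ha, Algebra.algebraMap_self_apply]

end ResolventOfAnalytic

section MellinTransform

open MeasureTheory

variable {μ : ℂ}

lemma hasMellin_inv_exp_sub_one (hμ : 1 < μ.re) :
    HasMellin (fun t : ℝ => ((Real.exp t - 1)⁻¹ : ℂ)) μ (Complex.Gamma μ * riemannZeta μ) := by
  have hgeom (t : ℝ) (ht : t ∈ Ioi 0) :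
      HasSum (fun n : ℕ => 1 * (Real.exp (-(n + 1) * t) : ℂ)) ((Real.exp t - 1)⁻¹ : ℂ) := by
    have hlt : Real.exp (-t) < 1 := Real.exp_lt_one_iff.2 (neg_neg_of_pos (mem_Ioi.1 ht))
    have h := (hasSum_geometric_of_lt_one (Real.exp_pos (-t)).le hlt).mul_left (Real.exp (-t))
    have hlim : Real.exp (-t) * (1 - Real.exp (-t))⁻¹ = (Real.exp t - 1)⁻¹ := by
      rw [← inv_inj, mul_inv, inv_inv, inv_inv, ← Real.exp_neg, neg_neg, mul_sub, mul_one,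
        ← Real.exp_add, add_neg_cancel, Real.exp_zero]
    rw [hlim] at h
    convert! Complex.hasSum_ofReal.2 h using 2
    · rw [one_mul, ← Real.exp_nat_mul, ← Real.exp_add]
      ring_nf
    · push_cast
      rfl
  have hsum := hasSum_mellin (a := fun _ : ℕ => 1) (p := fun n => (n : ℝ) + 1) (s := μ)
    (fun n => Or.inr (by positivity)) (by linarith) hgeom
    (by simpa using (summable_nat_add_iff 1).2 (Real.summable_one_div_nat_rpow.2 hμ))
  have hmellin : mellin (fun t : ℝ => ((Real.exp t - 1)⁻¹ : ℂ)) μ =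
      Complex.Gamma μ * riemannZeta μ := by
    rw [← hsum.tsum_eq, zeta_eq_tsum_one_div_nat_add_one_cpow hμ, ← tsum_mul_left]
    exact tsum_congr fun n => by push_cast; ring
  refine ⟨Integrable.of_integral_ne_zero ?_, hmellin⟩
  exact hmellin.trans_ne (mul_ne_zero (Complex.Gamma_ne_zero_of_re_pos (by linarith))
    (riemannZeta_ne_zero_of_one_le_re hμ.le))

lemma map_mellin {E F : Type*} [NormedAddCommGroup E] [NormedSpace ℂ E]
    [CompleteSpace E] [NormedAddCommGroup F] [NormedSpace ℂ F] [CompleteSpace F] (φ : E →L[ℂ] F)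
    {f : ℝ → E} (hf : MellinConvergent f μ) :
    φ (mellin f μ) = mellin (fun t => φ (f t)) μ := by
  rw [mellin, ← φ.integral_comp_comm hf]
  simp only [map_smul, mellin]

section BanachAlgebra

variable {A : Type*} [NormedCommRing A] [NormedAlgebra ℂ A] {a : A}

lemma ResolventBound.norm_resolvent_exp_le (h : ResolventBound (𝓟 (Ioi 0)) (1 - a)) :
    ∃ K, ∀ t : ℝ, 0 < t → (Real.exp t : ℂ) ∈ resolventSet ℂ a ∧
      ‖resolvent a (Real.exp t : ℂ)‖ ≤ K / (Real.exp t - 1) := by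
  obtain ⟨K, hK⟩ := h
  refine ⟨K, fun t ht => ?_⟩
  obtain ⟨v, hv, hvK⟩ := eventually_principal.1 hK (Real.exp t - 1)
    (sub_pos.2 (Real.one_lt_exp_iff.2 ht))
  rw [Complex.ofReal_sub, Complex.ofReal_one, map_sub, map_one, sub_add_sub_cancel] at hv
  have hunit : IsUnit (algebraMap ℂ A (Real.exp t) - a) := .of_mul_eq_one v hv
  refine ⟨hunit, ?_⟩
  rwa [resolvent, left_inv_eq_right_inv (Ring.inverse_mul_cancel _ hunit) hv]

lemma ResolventBound.mellinConvergent_resolvent_exp [CompleteSpace A]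
    (h : ResolventBound (𝓟 (Ioi 0)) (1 - a)) (hμ : 1 < μ.re) :
    MellinConvergent (fun t : ℝ => resolvent a (Real.exp t : ℂ)) μ := by
  obtain ⟨K, hK⟩ := h.norm_resolvent_exp_le
  have hcont : ContinuousOn (fun t : ℝ => (t : ℂ) ^ (μ - 1) • resolvent a (Real.exp t : ℂ))
      (Ioi 0) := fun t ht => by
    have hpow : ContinuousAt (fun t : ℝ => (t : ℂ) ^ (μ - 1)) t :=
      (continuousAt_cpow_const (Complex.ofReal_mem_slitPlane.2 ht)).comp
        Complex.continuous_ofReal.continuousAt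
    have hres : ContinuousAt (fun t : ℝ => resolvent a (Real.exp t : ℂ)) t :=
      (spectrum.hasDerivAt_resolvent_const_left (hK t ht).1).continuousAt.comp
        (f := fun t : ℝ => (Real.exp t : ℂ)) (by fun_prop)
    exact (hpow.smul hres).continuousWithinAt
  refine ((hasMellin_inv_exp_sub_one hμ).1.norm.const_mul K).mono'
    (hcont.aestronglyMeasurable measurableSet_Ioi)
    ((ae_restrict_mem measurableSet_Ioi).mono fun t ht => ?_)
  have hnorm : ‖((Real.exp t - 1)⁻¹ : ℂ)‖ = (Real.exp t - 1)⁻¹ := by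
    rw [← Complex.ofReal_one, ← Complex.ofReal_sub, norm_inv,
      Complex.norm_of_nonneg (sub_nonneg.2 (Real.one_le_exp (le_of_lt ht)))]
  rw [norm_smul, norm_smul, hnorm, mul_left_comm, ← div_eq_mul_inv]
  exact mul_le_mul_of_nonneg_left (hK t ht).2 (norm_nonneg _)

end BanachAlgebra

lemma coeff_eq_sum_of_sub_mul_eq_one {K : Type*} [Field K] {G Φ : K⟦X⟧}
    (hG : constantCoeff G = 0) {z : K} (hz : z ≠ 0) (h : (C z - G) * Φ = 1) (n : ℕ) :
    coeff n Φ = ∑ k ∈ Finset.range (n + 1), z⁻¹ ^ (k + 1) * coeff n (G ^ k) := by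
  have hC : (C z : K⟦X⟧) * C z⁻¹ = 1 := by rw [← map_mul, mul_inv_cancel₀ hz, map_one]
  have hgeom := mul_neg_geom_sum (C z⁻¹ * G) (n + 1)
  set S := ∑ k ∈ Finset.range (n + 1), (C z⁻¹ * G) ^ k with hS
  have hΦ : Φ = C z⁻¹ * S + G ^ (n + 1) * (Φ * C z⁻¹ ^ (n + 1)) := by
    rw [mul_pow] at hgeom
    linear_combination C z⁻¹ * S * h - Φ * hgeom - Φ * S * hC
  have hremainder : coeff n (G ^ (n + 1) * (Φ * C z⁻¹ ^ (n + 1))) = 0 :=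
    X_pow_dvd_iff.1 ((pow_dvd_pow_of_dvd (X_dvd_iff.2 hG) (n + 1)).mul_right _) n n.lt_succ_self
  rw [hΦ, map_add, hremainder, add_zero, coeff_C_mul, hS, map_sum, Finset.mul_sum]
  refine Finset.sum_congr rfl fun k _ => ?_
  rw [mul_pow, ← map_pow, coeff_C_mul, pow_succ']
  ring

lemma coeff_pow_eq_zero_of_lt {R : Type*} [CommSemiring R] {G : R⟦X⟧}
    (hG : constantCoeff G = 0) {n k : ℕ} (hnk : n < k) : coeff n (G ^ k) = 0 :=
  X_pow_dvd_iff.1 (pow_dvd_pow_of_dvd (X_dvd_iff.2 hG) k) n hnk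

open wienerAlgebra

variable {G : wienerAlgebra ℂ}

lemma mellin_coeff_resolvent_exp (hG : constantCoeff (G : ℂ⟦X⟧) = 0)
    (hres : ∀ t : ℝ, 0 < t → (Real.exp t : ℂ) ∈ resolventSet ℂ G) (hμ : 0 < μ.re) (n : ℕ) :
    mellin (fun t : ℝ => coeffCLM ℂ n (resolvent G (Real.exp t : ℂ))) μ =
      Complex.Gamma μ * ∑ k ∈ Finset.range (n + 1),
        1 / ((k : ℂ) + 1) ^ μ * coeff n ((G : ℂ⟦X⟧) ^ k) := by
  have hzero (k : ℕ) (hk : k ∉ Finset.range (n + 1)) : coeff n ((G : ℂ⟦X⟧) ^ k) = 0 :=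
    coeff_pow_eq_zero_of_lt hG (Nat.succ_le_iff.1 (not_lt.1 (Finset.mem_range.not.1 hk)))
  have hcoeff (t : ℝ) (ht : t ∈ Ioi 0) :
      HasSum (fun k : ℕ => coeff n ((G : ℂ⟦X⟧) ^ k) * (Real.exp (-(k + 1) * t) : ℂ))
        (coeffCLM ℂ n (resolvent G (Real.exp t : ℂ))) := by
    have hmul : (C (Real.exp t : ℂ) - (G : ℂ⟦X⟧)) * (resolvent G (Real.exp t : ℂ)) = 1 :=
      congr_arg Subtype.val (Ring.mul_inverse_cancel _ (hres t ht))
    rw [coeffCLM_apply, coeff_eq_sum_of_sub_mul_eq_one hG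
      (Complex.ofReal_ne_zero.2 (Real.exp_ne_zero t)) hmul]
    convert! (hasSum_sum_of_ne_finset_zero fun k hk => by rw [hzero k hk, mul_zero] :
      HasSum (fun k : ℕ => (Real.exp t : ℂ)⁻¹ ^ (k + 1) * coeff n ((G : ℂ⟦X⟧) ^ k)) _)
      using 2 with k
    rw [mul_comm, ← Complex.ofReal_inv, ← Complex.ofReal_pow, ← Real.exp_neg, ← Real.exp_nat_mul]
    push_cast
    ring_nf
  have hsum := hasSum_mellin (a := fun k : ℕ => coeff n ((G : ℂ⟦X⟧) ^ k))
    (p := fun k => (k : ℝ) + 1) (fun k => Or.inr (by positivity)) hμ hcoeff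
    (summable_of_ne_finset_zero (s := Finset.range (n + 1)) fun k hk => by
      rw [hzero k hk, norm_zero, zero_div])
  rw [← hsum.tsum_eq, Finset.mul_sum, tsum_eq_sum fun k hk => by
    rw [hzero k hk, mul_zero, zero_div]]
  refine Finset.sum_congr rfl fun k _ => ?_
  push_cast
  ring

theorem hasSum_coeff_pow_riemannZeta (hG : constantCoeff (G : ℂ⟦X⟧) = 0)
    (hG1 : eval ⟨1, by simp⟩ G = 1) (hres : ResolventBound (𝓟 (Ioi 0)) (1 - G)) (hμ : 1 < μ.re) :
    HasSum (fun n => ∑ k ∈ Finset.range (n + 1),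
      1 / ((k : ℂ) + 1) ^ μ * coeff n ((G : ℂ⟦X⟧) ^ k)) (riemannZeta μ) := by
  set e := eval (⟨1, by simp⟩ : Metric.closedBall (0 : ℂ) 1)
  obtain ⟨K, hK⟩ := hres.norm_resolvent_exp_le
  have hconv := hres.mellinConvergent_resolvent_exp hμ
  set L := mellin (fun t : ℝ => resolvent G (Real.exp t : ℂ)) μ with hL
  have hΓ : Complex.Gamma μ ≠ 0 := Complex.Gamma_ne_zero_of_re_pos (by linarith)
  have heval_resolvent (t : ℝ) (ht : t ∈ Ioi 0) :
      e (resolvent G (Real.exp t : ℂ)) = (Real.exp t - 1 : ℂ)⁻¹ := by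
    have h := congr_arg e (Ring.mul_inverse_cancel _ (hK t ht).1)
    rw [map_mul, map_sub, AlgHom.commutes, hG1, map_one, Algebra.algebraMap_self_apply] at h
    exact eq_inv_of_mul_eq_one_right h
  have hevalL : e L = Complex.Gamma μ * riemannZeta μ := by
    rw [← (hasMellin_inv_exp_sub_one hμ).2, hL, ← AlgHom.coe_toContinuousLinearMap,
      map_mellin _ hconv]
    exact setIntegral_congr_fun measurableSet_Ioi fun t ht =>
      congr_arg (_ • ·) (heval_resolvent t ht)
  refine (hasSum_mul_left_iff hΓ).1 ?_
  convert! hasSum_eval ⟨1, by simp⟩ L using 2 with n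
  · rw [one_pow, mul_one, ← coeffCLM_apply, map_mellin _ hconv,
      mellin_coeff_resolvent_exp hG (fun t ht => (hK t ht).1) (by linarith)]
  · exact hevalL.symm

end MellinTransform

section ZerosOfAddExpNeg

lemma strictMonoOn_div_sin : StrictMonoOn (fun x => x / Real.sin x) (Ioo 0 Real.pi) := by
  intro x hx y hy hxy
  have hsx := Real.sin_pos_of_mem_Ioo hx
  have hsy := Real.sin_pos_of_mem_Ioo hy
  have h := strictConcaveOn_sin_Icc.slope_anti_adjacent (left_mem_Icc.2 Real.pi_pos.le)
    (Ioo_subset_Icc_self hy) hx.1 hxy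
  rw [Real.sin_zero, sub_zero, sub_zero, div_lt_div_iff₀ (sub_pos.2 hxy) hx.1] at h
  rw [div_lt_div_iff₀ hsx hsy]
  linarith

lemma strictAntiOn_mul_cot : StrictAntiOn (fun x => x * Real.cot x) (Ioo 0 Real.pi) := by
  intro x hx y hy hxy
  have hsx := Real.sin_pos_of_mem_Ioo hx
  have hsy := Real.sin_pos_of_mem_Ioo hy
  have hsub : y - x ∈ Ioo 0 Real.pi := ⟨sub_pos.2 hxy, by linarith [hx.1, hy.2]⟩
  have h : (y - x) * Real.sin (y + x) < (y + x) * Real.sin (y - x) := by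
    rcases lt_or_ge (y + x) Real.pi with hlt | hge
    · have := strictMonoOn_div_sin hsub ⟨by linarith [hx.1, hy.1], hlt⟩ (by linarith [hx.1])
      rwa [div_lt_div_iff₀ (Real.sin_pos_of_mem_Ioo hsub)
        (Real.sin_pos_of_pos_of_lt_pi (by linarith [hx.1, hy.1]) hlt)] at this
    · have hneg : Real.sin (y + x) ≤ 0 := by
        rw [← neg_nonneg, ← Real.sin_sub_pi]
        exact Real.sin_nonneg_of_nonneg_of_le_pi (by linarith) (by linarith [hx.2, hy.2])
      exact (mul_nonpos_of_nonneg_of_nonpos hsub.1.le hneg).trans_lt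
        (mul_pos (by linarith [hx.1, hy.1]) (Real.sin_pos_of_mem_Ioo hsub))
  rw [Real.sin_add, Real.sin_sub] at h
  simp only [Real.cot_eq_cos_div_sin, mul_div_assoc']
  rw [div_lt_div_iff₀ hsy hsx]
  linarith

lemma exists_exp_mul_sin_eq :
    ∃ b ∈ Ioo 0 Real.pi, Real.exp (b * Real.cot b) * Real.sin b = b := by
  have hπ := Real.pi_gt_three
  have hsin (b : ℝ) (hb : b ∈ Icc 1 (Real.pi / 2)) : 0 < Real.sin b :=
    Real.sin_pos_of_pos_of_lt_pi (by linarith [hb.1]) (by linarith [hb.2])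
  have hcont : ContinuousOn (fun b => Real.exp (b * Real.cot b) * Real.sin b - b)
      (Icc 1 (Real.pi / 2)) := by
    simp only [Real.cot_eq_cos_div_sin]
    have : ContinuousOn (fun b => Real.cos b / Real.sin b) (Icc 1 (Real.pi / 2)) :=
      Real.continuous_cos.continuousOn.div Real.continuous_sin.continuousOn
        fun b hb => (hsin b hb).ne'
    fun_prop
  have hsin_one := hsin 1 ⟨le_rfl, by linarith⟩
  have hright : Real.exp (Real.pi / 2 * Real.cot (Real.pi / 2)) * Real.sin (Real.pi / 2) -
      Real.pi / 2 ≤ 0 := by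
    rw [Real.cot_eq_cos_div_sin, Real.cos_pi_div_two, Real.sin_pi_div_two, zero_div, mul_zero,
      Real.exp_zero]
    linarith
  have hleft : 0 ≤ Real.exp (1 * Real.cot 1) * Real.sin 1 - 1 := by
    have hcos := Real.cos_pos_of_mem_Ioo (x := 1) ⟨by linarith, by linarith⟩
    have hsum : 1 ≤ Real.cos 1 + Real.sin 1 := by nlinarith [Real.sin_sq_add_cos_sq 1]
    have hcot : Real.cot 1 * Real.sin 1 = Real.cos 1 := by
      rw [Real.cot_eq_cos_div_sin, div_mul_cancel₀ _ hsin_one.ne']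
    have hexp := mul_le_mul_of_nonneg_right (Real.add_one_le_exp (1 * Real.cot 1)) hsin_one.le
    linarith
  obtain ⟨b, hb, hb0⟩ := intermediate_value_Icc' (by linarith) hcont ⟨hright, hleft⟩
  exact ⟨b, ⟨by linarith [hb.1], by linarith [hb.2]⟩, sub_eq_zero.1 hb0⟩

lemma eq_mul_cot_of_exp_mul {a b c : ℝ} (hb : 0 < b) (hcos : Real.exp a * Real.cos b = c)
    (hsin : Real.exp a * Real.sin b = b) : Real.exp a = b / Real.sin b ∧ c = b * Real.cot b := by
  have hne : Real.sin b ≠ 0 := fun h => hb.ne' (by rw [← hsin, h, mul_zero])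
  have hexp : Real.exp a = b / Real.sin b := eq_div_of_mul_eq hne hsin
  refine ⟨hexp, ?_⟩
  rw [← hcos, hexp, Real.cot_eq_cos_div_sin]
  ring

lemma bounds_of_exp_mul_cos_eq {a b : ℝ} (hb : 0 < b) (hbπ : b < Real.pi)
    (hcos : Real.exp a * Real.cos b = a) (hsin : Real.exp a * Real.sin b = b) :
    0 < a ∧ a < 1 ∧ b < Real.pi / 2 := by
  obtain ⟨hexp, hcot⟩ := eq_mul_cot_of_exp_mul hb hcos hsin
  have hsin_pos := Real.sin_pos_of_pos_of_lt_pi hb hbπ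
  have ha : 0 < a := by
    rw [← Real.one_lt_exp_iff, hexp, one_lt_div hsin_pos]
    exact Real.sin_lt hb
  have hcos_pos : 0 < Real.cos b := by
    rwa [← hcos, mul_pos_iff_of_pos_left (Real.exp_pos a)] at ha
  have hb2 : b < Real.pi / 2 := by
    by_contra! h
    exact hcos_pos.not_ge (Real.cos_nonpos_of_pi_div_two_le_of_le h (by linarith))
  refine ⟨ha, ?_, hb2⟩
  have htan := Real.lt_tan hb hb2
  rw [Real.tan_eq_sin_div_cos, lt_div_iff₀ hcos_pos] at htan
  rwa [hcot, Real.cot_eq_cos_div_sin, mul_div_assoc', div_lt_one hsin_pos]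

lemma eq_of_exp_mul_cos_eq_sub {a₀ b₀ a b s : ℝ} (hb₀ : 0 < b₀) (hb₀π : b₀ < Real.pi)
    (hcos₀ : Real.exp a₀ * Real.cos b₀ = a₀) (hsin₀ : Real.exp a₀ * Real.sin b₀ = b₀)
    (hb : 0 < b) (hs : 0 ≤ s) (hcos : Real.exp a * Real.cos b = a - s)
    (hsin : Real.exp a * Real.sin b = b) (hle : a ^ 2 + b ^ 2 ≤ a₀ ^ 2 + b₀ ^ 2) :
    s = 0 ∧ a = a₀ ∧ b = b₀ := by
  obtain ⟨ha₀, ha₀1, hb₀2⟩ := bounds_of_exp_mul_cos_eq hb₀ hb₀π hcos₀ hsin₀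
  have hbπ : b < Real.pi := by nlinarith [Real.pi_gt_three]
  obtain ⟨hexp₀, hcot₀⟩ := eq_mul_cot_of_exp_mul hb₀ hcos₀ hsin₀
  obtain ⟨hexp, hcot⟩ := eq_mul_cot_of_exp_mul hb hcos hsin
  rcases lt_trichotomy b b₀ with h | rfl | h
  · have haa₀ : a < a₀ := by
      rw [← Real.exp_lt_exp, hexp, hexp₀]
      exact strictMonoOn_div_sin ⟨hb, hbπ⟩ ⟨hb₀, hb₀π⟩ h
    have hsa₀ : a₀ < a - s := by
      rw [hcot, hcot₀]
      exact strictAntiOn_mul_cot ⟨hb, hbπ⟩ ⟨hb₀, hb₀π⟩ h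
    linarith
  · have haa₀ : a = a₀ := Real.exp_injective (hexp.trans hexp₀.symm)
    exact ⟨by linarith, haa₀, rfl⟩
  · have haa₀ : a₀ < a := by
      rw [← Real.exp_lt_exp, hexp, hexp₀]
      exact strictMonoOn_div_sin ⟨hb₀, hb₀π⟩ ⟨hb, hbπ⟩ h
    nlinarith

variable {w x : ℂ} {s : ℝ}

lemma add_add_exp_neg_eq_zero_iff : s + (x + Complex.exp (-x)) = 0 ↔
    Real.exp (-x.re) * Real.cos |x.im| = -x.re - s ∧
      Real.exp (-x.re) * Real.sin |x.im| = |x.im| := by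
  rw [Complex.ext_iff]
  simp only [Complex.add_re, Complex.add_im, Complex.exp_re, Complex.exp_im, Complex.neg_re,
    Complex.neg_im, Real.cos_neg, Real.sin_neg, Complex.ofReal_re, Complex.ofReal_im,
    Complex.zero_re, Complex.zero_im, Real.cos_abs]
  refine and_congr ⟨fun h => by linarith, fun h => by linarith⟩ ?_
  rcases abs_cases x.im with ⟨h, -⟩ | ⟨h, -⟩ <;> rw [h]
  · exact ⟨fun h => by linarith, fun h => by linarith⟩
  · rw [Real.sin_neg]
    exact ⟨fun h => by linarith, fun h => by linarith⟩

lemma exp_mul_cos_abs_im_of_add_exp_neg (hw : w + Complex.exp (-w) = 0) :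
    Real.exp (-w.re) * Real.cos |w.im| = -w.re ∧
      Real.exp (-w.re) * Real.sin |w.im| = |w.im| := by
  simpa only [sub_zero] using (add_add_exp_neg_eq_zero_iff (s := 0)).1 (by simpa using hw)

lemma im_ne_zero_of_add_add_exp_neg (hs : 0 ≤ s) (hx : s + (x + Complex.exp (-x)) = 0) :
    x.im ≠ 0 := fun h0 => by
  have hcos := (add_add_exp_neg_eq_zero_iff.1 hx).1
  rw [h0, abs_zero, Real.cos_zero, mul_one] at hcos
  linarith [Real.add_one_le_exp (-x.re)]

lemma exists_add_exp_neg_eq_zero :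
    ∃ w : ℂ, w + Complex.exp (-w) = 0 ∧ 0 < w.im ∧ w.im < Real.pi := by
  obtain ⟨b, hb, hsin⟩ := exists_exp_mul_sin_eq
  refine ⟨⟨-(b * Real.cot b), b⟩, ?_, hb⟩
  have hcos : Real.exp (b * Real.cot b) * Real.cos b = b * Real.cot b := by
    rw [← div_mul_cancel₀ (Real.cos b) (Real.sin_pos_of_mem_Ioo hb).ne', ← Real.cot_eq_cos_div_sin,
      mul_left_comm, hsin, mul_comm]
  have hzero := (add_add_exp_neg_eq_zero_iff (s := 0) (x := ⟨-(b * Real.cot b), b⟩)).2 <| by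
    simpa only [neg_neg, abs_of_pos hb.1, sub_zero] using ⟨hcos, hsin⟩
  simpa only [Complex.ofReal_zero, zero_add] using hzero

lemma zero_of_add_add_exp_neg (hw : w + Complex.exp (-w) = 0) (hπ : |w.im| < Real.pi)
    (hs : 0 ≤ s) (hxw : ‖x‖ ≤ ‖w‖) (hx : s + (x + Complex.exp (-x)) = 0) :
    s = 0 ∧ (x = w ∨ x = conj w) := by
  obtain ⟨hcos₀, hsin₀⟩ := exp_mul_cos_abs_im_of_add_exp_neg hw
  obtain ⟨hcos, hsin⟩ := add_add_exp_neg_eq_zero_iff.1 hx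
  have him₀ : w.im ≠ 0 := im_ne_zero_of_add_add_exp_neg le_rfl (by simpa using hw)
  have him := im_ne_zero_of_add_add_exp_neg hs hx
  have hle : (-x.re) ^ 2 + |x.im| ^ 2 ≤ (-w.re) ^ 2 + |w.im| ^ 2 := by
    have h : ‖x‖ ^ 2 ≤ ‖w‖ ^ 2 := by gcongr
    rw [Complex.sq_norm, Complex.sq_norm, Complex.normSq_apply, Complex.normSq_apply] at h
    rw [sq_abs, sq_abs]
    linarith
  obtain ⟨hs0, hre, habs⟩ := eq_of_exp_mul_cos_eq_sub (abs_pos.2 him₀) hπ hcos₀ hsin₀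
    (abs_pos.2 him) hs hcos hsin hle
  rw [neg_inj] at hre
  refine ⟨hs0, (abs_eq_abs.1 habs).imp (fun h => Complex.ext hre h) fun h => ?_⟩
  exact Complex.ext (by simpa using hre) (by simpa using h)

lemma re_mul_one_add_neg (hw : w + Complex.exp (-w) = 0) (hπ : |w.im| < Real.pi) :
    (w * (1 + w)).re < 0 := by
  obtain ⟨hcos, hsin⟩ := exp_mul_cos_abs_im_of_add_exp_neg hw
  have him : w.im ≠ 0 := im_ne_zero_of_add_add_exp_neg le_rfl (by simpa using hw)
  obtain ⟨h0, h1, -⟩ := bounds_of_exp_mul_cos_eq (abs_pos.2 him) hπ hcos hsin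
  simp only [Complex.mul_re, Complex.add_re, Complex.add_im, Complex.one_re, Complex.one_im]
  nlinarith [sq_nonneg w.im]

end ZerosOfAddExpNeg

section LambertW

variable {w z : ℂ} {k : ℤ}

lemma mul_exp_eq_neg_one_iff : w * Complex.exp w = -1 ↔ w + Complex.exp (-w) = 0 := by
  rw [← eq_div_iff (Complex.exp_ne_zero w), Complex.exp_neg, ← eq_neg_iff_add_eq_zero, neg_div,
    one_div]

lemma coe_im_add_arg_of_mul_exp_eq_neg_one (hw : w * Complex.exp w = -1) :
    ((w.im + w.arg : ℝ) : Real.Angle) = Real.pi := by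
  have hw0 : w ≠ 0 := by
    rintro rfl
    simp at hw
  rw [← Complex.arg_neg_one, ← hw, Complex.arg_mul_coe_angle hw0 (Complex.exp_ne_zero w),
    Complex.arg_exp, Real.Angle.coe_toIocMod, Real.Angle.coe_add, add_comm]

lemma im_add_arg_eq_of_mem_Ioo (hw : w * Complex.exp w = -1)
    (hk : w.im + w.arg ∈ Ioo ((2 * k - 1) * Real.pi) ((2 * k + 3) * Real.pi)) :
    w.im + w.arg = (2 * k + 1) * Real.pi := by
  obtain ⟨m, hm⟩ := Real.Angle.angle_eq_iff_two_pi_dvd_sub.1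
    (coe_im_add_arg_of_mul_exp_eq_neg_one hw)
  have hm : w.im + w.arg = (2 * m + 1) * Real.pi := by linear_combination hm
  rw [hm, mem_Ioo, mul_lt_mul_iff_left₀ Real.pi_pos, mul_lt_mul_iff_left₀ Real.pi_pos] at hk
  have hkm : 2 * k - 1 < 2 * m + 1 ∧ 2 * m + 1 < 2 * k + 3 := by exact_mod_cast hk
  rw [hm, show m = k by omega]

lemma lambertW_spec (h : ∃ w ∈ lambertWRange k, w * Complex.exp w = z) :
    lambertW k z ∈ lambertWRange k ∧ lambertW k z * Complex.exp (lambertW k z) = z := by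
  rw [lambertW, dif_pos h]
  exact h.choose_spec

lemma mem_lambertWRange_of_im_add_arg_eq (h0 : w.im ≠ 0)
    (h : w.im + w.arg = (2 * k + 1) * Real.pi) : w ∈ lambertWRange k :=
  Or.inl ⟨by rw [h]; gcongr; linarith, h.le, fun h => h0 h.1⟩

lemma exists_mem_lambertWRange (hk : k = 0 ∨ k = -1) :
    ∃ w ∈ lambertWRange k, w * Complex.exp w = -1 := by
  obtain ⟨w, hw, him, hπ⟩ := exists_add_exp_neg_eq_zero
  rw [← mul_exp_eq_neg_one_iff] at hw
  rcases hk with rfl | rfl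
  · have harg := Complex.arg_nonneg_iff.2 him.le
    have harg_le := Complex.arg_le_pi w
    exact ⟨w, mem_lambertWRange_of_im_add_arg_eq him.ne' (im_add_arg_eq_of_mem_Ioo hw
      ⟨by push_cast; linarith, by push_cast; linarith⟩), hw⟩
  · set v := conj w
    have hv_im : v.im = -w.im := Complex.conj_im w
    have hvw : v * Complex.exp v = -1 := by
      rw [Complex.exp_conj, ← map_mul, hw, map_neg, map_one]
    have harg := Complex.arg_neg_iff.2 (show v.im < 0 by linarith)
    have harg_gt := Complex.neg_pi_lt_arg v
    exact ⟨v, mem_lambertWRange_of_im_add_arg_eq (by linarith) (im_add_arg_eq_of_mem_Ioo hvw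
      ⟨by push_cast; linarith, by push_cast; linarith⟩), hvw⟩

lemma abs_im_lt_pi_of_mem_lambertWRange (hk : k = 0 ∨ k = -1) (hmem : w ∈ lambertWRange k)
    (hw : w * Complex.exp w = -1) : |w.im| < Real.pi := by
  have him : w.im ≠ 0 := im_ne_zero_of_add_add_exp_neg le_rfl
    (by simpa using mul_exp_eq_neg_one_iff.1 hw)
  obtain ⟨hlow, hhigh, -⟩ := hmem.resolve_right fun h => him h.2.1
  have hsum := im_add_arg_eq_of_mem_Ioo hw
    ⟨hlow, hhigh.trans_lt (mul_lt_mul_of_pos_right (by linarith) Real.pi_pos)⟩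
  rcases hk with rfl | rfl
  · rw [Int.cast_zero, mul_zero, zero_add, one_mul] at hsum
    have hpos : 0 < w.im := him.symm.lt_of_le (by linarith [Complex.arg_le_pi w])
    have harg : 0 < w.arg := (Complex.arg_nonneg_iff.2 hpos.le).lt_of_ne fun h =>
      him (Complex.arg_eq_zero_iff.1 h.symm).2
    rw [abs_of_pos hpos]
    linarith
  · rw [Int.cast_neg, Int.cast_one] at hsum
    have hneg : w.im < 0 := by linarith [Complex.neg_pi_lt_arg w]
    rw [abs_of_neg hneg]
    linarith [Complex.arg_neg_iff.2 hneg]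

lemma lambertW_neg_one_spec (hk : k = 0 ∨ k = -1) :
    lambertW k (-1) * Complex.exp (lambertW k (-1)) = -1 ∧ |(lambertW k (-1)).im| < Real.pi := by
  obtain ⟨hmem, hw⟩ := lambertW_spec (exists_mem_lambertWRange hk)
  exact ⟨hw, abs_im_lt_pi_of_mem_lambertWRange hk hmem hw⟩

end LambertW

section AssociatedStirling

lemma sup_erase_parts {α : Type*} [GeneralizedBooleanAlgebra α] [DecidableEq α] {u b : α}
    (P : Finpartition u) (hb : b ∈ P.parts) : (P.parts.erase b).sup id = u \ b := by
  refine (Disjoint.sdiff_eq_of_sup_eq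
    (P.supIndep (Finset.erase_subset b P.parts) hb (Finset.notMem_erase b P.parts)) ?_).symm
  rw [← Finset.sup_insert, Finset.insert_erase hb, P.sup_parts]

variable {α : Type*} [DecidableEq α] {m : ℕ}

/-- The partitions of the finite set `s` into `k` blocks of size at least `m`, whose number is the
associated Stirling number of the second kind. -/
def partitionsOfMinCard (m : ℕ) (s : Finset α) (k : ℕ) : Finset (Finpartition s) :=
  {P | P.parts.card = k ∧ ∀ b ∈ P.parts, m ≤ b.card}

lemma mem_partitionsOfMinCard {s : Finset α} {k : ℕ} {P : Finpartition s} :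
    P ∈ partitionsOfMinCard m s k ↔ P.parts.card = k ∧ ∀ b ∈ P.parts, m ≤ b.card := by
  simp [partitionsOfMinCard]

lemma card_partitionsOfMinCard_zero (s : Finset α) :
    (partitionsOfMinCard m s 0).card = if s.card = 0 then 1 else 0 := by
  split_ifs with hs
  · obtain rfl := Finset.card_eq_zero.1 hs
    refine Finset.card_eq_one.2 ⟨⊥, Finset.eq_singleton_iff_unique_mem.2 ⟨?_, fun P hP => ?_⟩⟩
    · simp [mem_partitionsOfMinCard]
    · have hparts := Finset.card_eq_zero.1 (mem_partitionsOfMinCard.1 hP).1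
      exact Finpartition.ext (by simp [hparts])
  · refine Finset.card_eq_zero.2 (Finset.eq_empty_of_forall_notMem fun P hP => hs ?_)
    have hparts := Finset.card_eq_zero.1 (mem_partitionsOfMinCard.1 hP).1
    rw [Finset.card_eq_zero, ← P.sup_parts, hparts, Finset.sup_empty, Finset.bot_eq_empty]

lemma card_filter_mem_parts {s b : Finset α} (hb : b.Nonempty) (hbs : b ⊆ s) (hmb : m ≤ b.card)
    (k : ℕ) : ((partitionsOfMinCard m s (k + 1)).filter fun P => b ∈ P.parts).card =
      (partitionsOfMinCard m (s \ b) k).card := by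
  refine (Finset.card_bij (fun Q _ => Q.extend hb.ne_empty Finset.sdiff_disjoint
    (Finset.sdiff_union_of_subset hbs)) ?_ ?_ ?_).symm
  · intro Q hQ
    obtain ⟨hcard, hmin⟩ := mem_partitionsOfMinCard.1 hQ
    rw [Finset.mem_filter, mem_partitionsOfMinCard, Finpartition.card_extend, hcard]
    exact ⟨⟨rfl, Finset.forall_mem_insert _ _ _ |>.2 ⟨hmb, hmin⟩⟩, Finset.mem_insert_self _ _⟩
  · intro Q _ Q' _ h
    have hnot (R : Finpartition (s \ b)) : b ∉ R.parts := fun hbR =>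
      hb.ne_empty (disjoint_self.1
        (Finset.disjoint_of_subset_left (R.le hbR) Finset.sdiff_disjoint))
    have hparts : insert b Q.parts = insert b Q'.parts := congr_arg Finpartition.parts h
    refine Finpartition.ext ?_
    rw [← Finset.erase_insert (hnot Q), hparts, Finset.erase_insert (hnot Q')]
  · intro P hP
    obtain ⟨hP, hbP⟩ := Finset.mem_filter.1 hP
    obtain ⟨hcard, hmin⟩ := mem_partitionsOfMinCard.1 hP
    refine ⟨P.ofSubset (Finset.erase_subset b P.parts) (sup_erase_parts P hbP),
      mem_partitionsOfMinCard.2 ⟨?_, fun c hc => hmin c (Finset.mem_of_mem_erase hc)⟩,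
      Finpartition.ext (Finset.insert_erase hbP)⟩
    exact (Finset.card_erase_of_mem hbP).trans (by rw [hcard, Nat.add_sub_cancel])

/-- Double counting of the pairs of a partition and one of its blocks. -/
lemma succ_mul_card_partitionsOfMinCard (hm : 0 < m) (s : Finset α) (k : ℕ) :
    (k + 1) * (partitionsOfMinCard m s (k + 1)).card =
      ∑ b ∈ s.powerset, if m ≤ b.card then (partitionsOfMinCard m (s \ b) k).card else 0 := by
  have hblocks : ∀ P ∈ partitionsOfMinCard m s (k + 1),
      (s.powerset.filter fun b => b ∈ P.parts).card = k + 1 := fun P hP => by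
    rw [← (mem_partitionsOfMinCard.1 hP).1, Finset.filter_mem_eq_inter, Finset.inter_eq_right.2
      fun b hb => Finset.mem_powerset.2 (P.subset hb)]
  rw [mul_comm, ← smul_eq_mul, ← Finset.sum_const, ← Finset.sum_congr rfl hblocks]
  refine (Finset.sum_card_bipartiteAbove_eq_sum_card_bipartiteBelow _).trans
    (Finset.sum_congr rfl fun b hb => ?_)
  split_ifs with hmb
  · exact card_filter_mem_parts (Finset.card_pos.1 (hm.trans_le hmb)) (Finset.mem_powerset.1 hb)
      hmb k
  · exact Finset.card_eq_zero.2 (Finset.filter_eq_empty_iff.2 fun P hP hbP =>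
      hmb ((mem_partitionsOfMinCard.1 hP).2 b hbP))

section GeneratingFunction

variable (K : Type*) [Field K]

/-- The series `∑ Xʲ / j!` over `j ≥ m`: the exponential generating function of a single block of
size at least `m`. -/
noncomputable def expTail (m : ℕ) : K⟦X⟧ := mk fun j => if m ≤ j then (j.factorial : K)⁻¹ else 0

lemma expTail_two [Algebra ℚ K] : expTail K 2 = exp K - 1 - X := by
  ext (_ | _ | j) <;> simp [expTail, coeff_exp, coeff_one, coeff_X]

variable [CharZero K]

lemma card_partitionsOfMinCard (hm : 0 < m) (s : Finset α) (k : ℕ) :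
    ((partitionsOfMinCard m s k).card : K) =
      s.card.factorial / k.factorial * coeff s.card (expTail K m ^ k) := by
  have hfac (j : ℕ) : (j.factorial : K) ≠ 0 := Nat.cast_ne_zero.2 j.factorial_ne_zero
  induction k generalizing s with
  | zero =>
    rw [card_partitionsOfMinCard_zero, pow_zero, coeff_one]
    split_ifs with hs <;> simp [hs]
  | succ k ih =>
    have hk : (k + 1 : K) ≠ 0 := Nat.cast_add_one_ne_zero k
    have hrec := congr_arg (Nat.cast : ℕ → K) (succ_mul_card_partitionsOfMinCard hm s k)
    push_cast at hrec
    refine mul_left_cancel₀ hk (hrec.trans ?_)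
    have hsdiff : ∀ b ∈ s.powerset, (if m ≤ b.card then
        ((partitionsOfMinCard m (s \ b) k).card : K) else 0) = if m ≤ b.card then
          ((s.card - b.card).factorial : K) / k.factorial *
            coeff (s.card - b.card) (expTail K m ^ k) else 0 := fun b hb => by
      rw [ih, Finset.card_sdiff_of_subset (Finset.mem_powerset.1 hb)]
    rw [Finset.sum_congr rfl hsdiff, Finset.sum_powerset_apply_card (fun j => if m ≤ j then
      ((s.card - j).factorial : K) / k.factorial * coeff (s.card - j) (expTail K m ^ k) else 0),
      pow_succ', coeff_mul, Finset.Nat.sum_antidiagonal_eq_sum_range_succ_mk, Finset.mul_sum,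
      Finset.mul_sum]
    refine Finset.sum_congr rfl fun j hj => ?_
    rw [nsmul_eq_mul, Nat.cast_choose K (Finset.mem_range_succ_iff.1 hj), expTail, coeff_mk,
      Nat.factorial_succ, Nat.cast_mul, Nat.cast_succ]
    have := hfac j
    have := hfac k
    have := hfac (s.card - j)
    split_ifs
    · field_simp
    · simp

lemma associatedStirlingSecond_eq (hm : 0 < m) (n k : ℕ) :
    (associatedStirlingSecond m n k : K) =
      n.factorial / k.factorial * coeff n (expTail K m ^ k) := by
  have h := card_partitionsOfMinCard K hm (Finset.univ : Finset (Fin n)) k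
  rw [Finset.card_fin] at h
  rw [← h]
  unfold associatedStirlingSecond partitionsOfMinCard
  congr!

end GeneratingFunction

lemma associatedPolyBernoulli_mul_pow_div_factorial (hm : 0 < m) (μ w : ℂ) (n : ℕ) :
    associatedPolyBernoulli m μ n * w ^ n / n.factorial = ∑ k ∈ Finset.range (n + 1),
      1 / ((k : ℂ) + 1) ^ μ * coeff n ((-rescale (-w) (expTail ℂ m)) ^ k) := by
  rw [associatedPolyBernoulli, Finset.sum_mul, Finset.sum_div]
  refine Finset.sum_congr rfl fun k hk => ?_
  have hsign : (-1 : ℂ) ^ (n - k) = (-1) ^ k * (-1) ^ n := by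
    obtain ⟨j, rfl⟩ := Nat.exists_eq_add_of_le (Finset.mem_range_succ_iff.1 hk)
    rw [Nat.add_sub_cancel_left, pow_add, ← mul_assoc, ← mul_pow, neg_one_mul, neg_neg, one_pow,
      one_mul]
  have hcoeff : coeff n ((-rescale (-w) (expTail ℂ m)) ^ k) =
      (-1) ^ k * ((-1) ^ n * w ^ n * coeff n (expTail ℂ m ^ k)) := by
    have hC : (-1 : ℂ⟦X⟧) ^ k = C ((-1) ^ k) := by rw [map_pow, map_neg, map_one]
    rw [neg_pow, hC, coeff_C_mul, ← map_pow, coeff_rescale, neg_pow w]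
  rw [associatedStirlingSecond_eq ℂ hm, hsign, hcoeff]
  have hk0 : (k.factorial : ℂ) ≠ 0 := Nat.cast_ne_zero.2 k.factorial_ne_zero
  have hn0 : (n.factorial : ℂ) ≠ 0 := Nat.cast_ne_zero.2 n.factorial_ne_zero
  field_simp

end AssociatedStirling

section ZetaSeries

open wienerAlgebra

lemma hasSum_coeff_rescale_expTail_two (w x : ℂ) :
    HasSum (fun n => coeff n (rescale w (expTail ℂ 2)) * x ^ n)
      (Complex.exp (w * x) - 1 - w * x) := by
  have hexp : HasSum (fun n => coeff n (rescale w (exp ℂ)) * x ^ n) (Complex.exp (w * x)) := by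
    rw [Complex.exp_eq_exp_ℂ]
    convert! NormedSpace.exp_series_hasSum_exp' (𝕂 := ℂ) (w * x) using 2 with n
    simp only [coeff_rescale, coeff_exp, one_div, map_inv₀, map_natCast, mul_pow, smul_eq_mul]
    ring
  have hone : HasSum (fun n => coeff n (rescale w (1 : ℂ⟦X⟧)) * x ^ n) 1 := by
    have h := hasSum_single (f := fun n => coeff n (rescale w (1 : ℂ⟦X⟧)) * x ^ n) 0 fun n hn => by
      simp [coeff_one, hn]
    simpa using h
  have hX : HasSum (fun n => coeff n (rescale w (X : ℂ⟦X⟧)) * x ^ n) (w * x) := by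
    have h := hasSum_single (f := fun n => coeff n (rescale w (X : ℂ⟦X⟧)) * x ^ n) 1 fun n hn => by
      simp [coeff_X, hn]
    simpa using h
  simpa only [expTail_two, map_sub, sub_mul] using (hexp.sub hone).sub hX

lemma resolventBound_of_eval_eq_mul_add_exp_neg {w : ℂ} (hw : w + Complex.exp (-w) = 0)
    (hπ : |w.im| < Real.pi) {a : wienerAlgebra ℂ}
    (ha : ∀ x, eval x a = w * x + Complex.exp (-(w * x))) : ResolventBound (𝓟 (Ioi 0)) a := by
  set h : ℂ → ℂ := fun x => w * x + Complex.exp (-(w * x))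
  have hw0 : w ≠ 0 := by
    rintro rfl
    simp at hw
  have hnorm {x : ℂ} (hx : x ∈ Metric.closedBall (0 : ℂ) 1) : ‖w * x‖ ≤ ‖w‖ := by
    rw [norm_mul]
    exact mul_le_of_le_one_right (norm_nonneg w) (mem_closedBall_zero_iff.1 hx)
  have hderiv (z : ℂ) (hz : h z = 0) : z * deriv h z = w * z * (1 + w * z) := by
    have hd : HasDerivAt h (w * 1 + Complex.exp (-(w * z)) * -(w * 1)) z :=
      ((hasDerivAt_id z).const_mul w).add ((hasDerivAt_id z).const_mul w).neg.cexp
    rw [hd.deriv]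
    linear_combination -(w * z) * hz
  have hconj : conj w + Complex.exp (-conj w) = 0 := by
    rw [← map_neg, Complex.exp_conj, ← map_add, hw, map_zero]
  have hconjπ : |(conj w).im| < Real.pi := by rwa [Complex.conj_im, abs_neg]
  refine resolventBound_of_eval (h := h) (Z := {1, conj w / w}) (fun x _ => by fun_prop) ha ?_ ?_ ?_
  · simp only [Finset.mem_insert, Finset.mem_singleton]
    rintro z (rfl | rfl)
    · have h1 : h 1 = 0 := by simpa [h] using hw
      refine ⟨norm_one, h1, ?_⟩
      rw [hderiv 1 h1, mul_one]
      exact re_mul_one_add_neg hw hπ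
    · have hz : h (conj w / w) = 0 := by rwa [← mul_div_cancel₀ (conj w) hw0] at hconj
      refine ⟨by simp [hw0], hz, ?_⟩
      rw [hderiv _ hz, mul_div_cancel₀ _ hw0]
      exact re_mul_one_add_neg hconj hconjπ
  · intro x hx hx0
    rcases (zero_of_add_add_exp_neg hw hπ le_rfl (hnorm hx) (by simpa using hx0)).2 with h | h
    · exact Finset.mem_insert.2 (Or.inl (mul_left_cancel₀ hw0 (h.trans (mul_one w).symm)))
    · exact Finset.mem_insert_of_mem <| Finset.mem_singleton.2 <|
        eq_div_of_mul_eq hw0 ((mul_comm x w).trans h)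
  · intro s hs x hx hx0
    exact hs.ne' (zero_of_add_add_exp_neg hw hπ hs.le (hnorm hx) hx0).1

theorem hasSum_associatedPolyBernoulli_two {w : ℂ} (hw : w + Complex.exp (-w) = 0)
    (hπ : |w.im| < Real.pi) {μ : ℂ} (hμ : 1 < μ.re) :
    HasSum (fun n => associatedPolyBernoulli 2 μ n * w ^ n / n.factorial) (riemannZeta μ) := by
  have hsum := hasSum_coeff_rescale_expTail_two (-w)
  obtain ⟨G, hG⟩ : ∃ G : wienerAlgebra ℂ, (G : ℂ⟦X⟧) = -rescale (-w) (expTail ℂ 2) :=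
    ⟨⟨_, neg_mem (mem_iff.2 (by simpa using (hsum 1).summable.norm))⟩, rfl⟩
  have heval (x : Metric.closedBall (0 : ℂ) 1) :
      eval x (1 - G) = w * x + Complex.exp (-(w * x)) := by
    have hGx := (hasSum_eval x G).unique (by simpa [hG] using (hsum x).neg)
    rw [map_sub, map_one, hGx]
    ring
  have hG1 : eval ⟨1, by simp⟩ G = 1 := by
    have h := heval ⟨1, by simp⟩
    rw [map_sub, map_one, mul_one, hw] at h
    exact (sub_eq_zero.1 h).symm
  have hG0 : constantCoeff (G : ℂ⟦X⟧) = 0 := by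
    rw [hG, ← coeff_zero_eq_constantCoeff_apply, map_neg, coeff_rescale, expTail, coeff_mk]
    simp
  have hres := resolventBound_of_eval_eq_mul_add_exp_neg hw hπ heval
  simpa only [associatedPolyBernoulli_mul_pow_div_factorial two_pos, hG] using
    hasSum_coeff_pow_riemannZeta hG0 hG1 hres hμ

end ZetaSeries

theorem mainTheorem3 (μ : ℂ) (hμ : 1 < μ.re) (k : ℤ) (hk : k = 0 ∨ k = -1) :
    HasSum (fun n : ℕ => associatedPolyBernoulli 2 μ n * lambertW k (-1) ^ n / (n.factorial : ℂ))
      (riemannZeta μ) := by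
  obtain ⟨hw, hπ⟩ := lambertW_neg_one_spec hk
  exact hasSum_associatedPolyBernoulli_two (mul_exp_eq_neg_one_iff.1 hw) hπ hμ
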